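/- Let $\Omega$ be a locally compact Hausdorff space, and let $M(\Omega)$ be the Banach space of complex regular Borel measures on $\Omega$ with the total variation norm $\|\mu\|=|\mu|(\Omega)$. Definitions. For a Banach space $E$ with dual $E'$, $1\le p,q<\infty$, $n\in\mathbb N=\{1,2,\dots\}$ and $x=(x_1,\dots,x_n)\in E^n$, let $$\mu_{p,n}(x)=\sup\Big\{\Big(\sum_{i=1}^n|\langle x_i,\varphi\rangle|^p\Big)^{1/p}:\varphi\in E',\ \|\varphi\|\le1\Big\}$$ be the weak $p$-summing norm (for elements of $(E')^n$ it is computed in the Banach space $E'$), and let $$\|x\|_n^{(p,q)}=\sup\Big\{\Big(\sum_{i=1}^n|\langle x_i,\lambda_i\rangle|^q\Big)^{1/q}:\lambda=(\lambda_1,\dots,\lambda_n)\in(E')^n,\ \mu_{p,n}(\lambda)\le1\Big\},$$ which for $p\le q$ is the weak $(p,q)$-multi-norm over $E$. A multi-norm over $E$ is a sequence of norms $\|\cdot\|_n$ on $E^n$ $(n\in\mathbb N)$, with $\|\cdot\|_1$ the norm of $E$, such that for all $n\ge2$: $\|\cdot\|_n$ is invariant under permutations of the coordinates; $\|(\alpha_1x_1,\dots,\alpha_nx_n)\|_n\le\max_i|\alpha_i|\,\|(x_1,\dots,x_n)\|_n$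 for $\alpha_1,\dots,\alpha_n\in\mathbb C$; $\|(x_1,\dots,x_{n-1},0)\|_n=\|(x_1,\dots,x_{n-1})\|_{n-1}$; and $\|(x_1,\dots,x_{n-1},x_{n-1})\|_n=\|(x_1,\dots,x_{n-1})\|_{n-1}$. The maximum multi-norm over $E$ is the multi-norm over $E$ that dominates every multi-norm over $E$. A measurable partition $\mathbf X=(X_1,\dots,X_n)$ of $\Omega$ consists of pairwise disjoint Borel sets, some possibly empty, with union $\Omega$. For a Borel set $X$ and $\mu\in M(\Omega)$, $P_X(\mu)(E)=\mu(X\cap E)$. For positive measures, $\vee$ denotes the least upper bound; explicitly, $(\mu\vee\nu)(E)=\sup\{\mu(E_1)+\nu(E_2)\}$ over the measurable partitions $(E_1,E_2)$ of $E$. Theorem. (1) The maximum multi-norm over $M(\Omega)$ is given by $$\|(\mu_1,\dots,\mu_n)\|_n^{\max}=\big\|\,|\mu_1|\vee\cdots\vee|\mu_n|\,\big\|\qquad(n\in\mathbb N,\ \mu_1,\dots,\mu_n\in M(\Omega)).$$ (2) Let $1\le q<\infty$. The weak $(1,q)$-multi-norm over $M(\Omega)$ is given by $$\|(\mu_1,\dots,\mu_n)\|_n^{(1,q)}=\sup_{\mathbf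 X}\Big(\sum_{i=1}^n\|P_{X_i}(\mu_i)\|^q\Big)^{1/q}\qquad(n\in\mathbb N,\ \mu_1,\dots,\mu_n\in M(\Omega)),$$ where the supremum, which is finite, is taken over all measurable partitions $\mathbf X=(X_1,\dots,X_n)$ of $\Omega$. -/

import Mathlib

open MeasureTheory Set
open scoped ENNReal NNReal

noncomputable section

/-! ### Multi-norms over a normed space -/

section MultiNorm

variable {E : Type*} [NormedAddCommGroup E] [NormedSpace ℂ E]

/-- The weak `p`-summing norm
`μ_{p,n}(x) = sup {(∑ |⟨x_i, φ⟩|^p)^{1/p} : φ ∈ E', ‖φ‖ ≤ 1}` of `x ∈ E^n`. -/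
def weakSummingNorm (p : ℝ) {n : ℕ} (x : Fin n → E) : ℝ :=
  sSup {r : ℝ | ∃ φ : StrongDual ℂ E, ‖φ‖ ≤ 1 ∧ r = (∑ i, ‖φ (x i)‖ ^ p) ^ (1 / p)}

/-- The weak `(p,q)`-multi-norm
`‖x‖_n^{(p,q)} = sup {(∑ |⟨x_i, φ_i⟩|^q)^{1/q} : φ ∈ (E')^n, μ_{p,n}(φ) ≤ 1}` of `x ∈ E^n`.
Here `μ_{p,n}(φ)` is computed in the Banach space `E'`, so against the unit ball of `E''`. -/
def weakMultiNorm (p q : ℝ) {n : ℕ} (x : Fin n → E) : ℝ :=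
  sSup {r : ℝ | ∃ φ : Fin n → StrongDual ℂ E,
    weakSummingNorm p φ ≤ 1 ∧ r = (∑ i, ‖φ i (x i)‖ ^ q) ^ (1 / q)}

/-- `N = (N 1, N 2, …)` is a multi-norm over `E`: each `N n` (`n ≥ 1`) is a norm on `E^n`, `N 1` is
the norm of `E`, and the remaining fields hold. The value `N 0` is irrelevant.
In `smul_le` the norm `‖α‖` of `α : Fin n → ℂ` is the maximum of the `|α_i|`. -/
structure IsMultiNorm (N : (n : ℕ) → (Fin n → E) → ℝ) : Prop where
  add_le : ∀ n, 1 ≤ n → ∀ x y : Fin n → E, N n (x + y) ≤ N n x + N n y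
  smul : ∀ n, 1 ≤ n → ∀ (c : ℂ) (x : Fin n → E), N n (c • x) = ‖c‖ * N n x
  eq_zero : ∀ n, 1 ≤ n → ∀ x : Fin n → E, N n x = 0 → x = 0
  one : ∀ x : E, N 1 (fun _ => x) = ‖x‖
  perm : ∀ n, 2 ≤ n → ∀ (σ : Equiv.Perm (Fin n)) (x : Fin n → E), N n (x ∘ σ) = N n x
  smul_le : ∀ n, 2 ≤ n → ∀ (α : Fin n → ℂ) (x : Fin n → E),
    N n (fun i => α i • x i) ≤ ‖α‖ * N n x
  snoc_zero : ∀ n, 1 ≤ n → ∀ x : Fin n → E,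
    N (n + 1) (Fin.snoc (α := fun _ => E) x 0) = N n x
  snoc_last : ∀ n, ∀ x : Fin (n + 1) → E,
    N (n + 2) (Fin.snoc (α := fun _ => E) x (x (Fin.last n))) = N (n + 1) x

/-- `N` is the maximum multi-norm over `E`: it is a multi-norm over `E`, and it dominates every
multi-norm over `E`. -/
def IsMaximumMultiNorm (N : (n : ℕ) → (Fin n → E) → ℝ) : Prop :=
  IsMultiNorm N ∧ ∀ N' : (n : ℕ) → (Fin n → E) → ℝ, IsMultiNorm N' →
    ∀ n, 1 ≤ n → ∀ x : Fin n → E, N' n x ≤ N n x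

end MultiNorm

/-! ### Total variation and regularity -/

section Aux

theorem variation_complexMeasure_lt_top {Ω : Type*} [MeasurableSpace Ω] (μ : ComplexMeasure Ω) :
    μ.variation univ < ∞ := by
  have h : μ.variation ≤ (ComplexMeasure.re μ).totalVariation
      + (ComplexMeasure.im μ).totalVariation := by
    apply VectorMeasure.variation_le_of_forall_enorm_le
    intro E hE
    have h1 : ‖μ E‖ₑ ≤ ‖(μ E).re‖ₑ + ‖(μ E).im‖ₑ := by
      have := Complex.norm_le_abs_re_add_abs_im (μ E)
      rw [← Real.norm_eq_abs, ← Real.norm_eq_abs] at this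
      have h2 := ENNReal.ofReal_le_ofReal this
      rwa [ENNReal.ofReal_add (norm_nonneg _) (norm_nonneg _), ofReal_norm, ofReal_norm,
        ofReal_norm] at h2
    refine h1.trans ?_
    rw [Measure.add_apply]
    exact add_le_add ((ComplexMeasure.re μ).enorm_le_totalVariation E)
      ((ComplexMeasure.im μ).enorm_le_totalVariation E)
  refine (h univ).trans_lt ?_
  rw [Measure.add_apply]
  exact ENNReal.add_lt_top.2 ⟨measure_lt_top _ _, measure_lt_top _ _⟩

instance isFiniteMeasure_variation_complexMeasure {Ω : Type*} [MeasurableSpace Ω]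
    (μ : ComplexMeasure Ω) : IsFiniteMeasure μ.variation :=
  ⟨variation_complexMeasure_lt_top μ⟩

/-- On finite measures, Mathlib's supremum of measures (the least measure above both) is given by
`(μ ∨ ν)(E) = sup {μ(E₁) + ν(E₂) : (E₁, E₂) a measurable partition of E}`. -/
theorem measure_sup_apply_eq {Ω : Type*} [MeasurableSpace Ω] (μ ν : Measure Ω)
    [IsFiniteMeasure μ] [IsFiniteMeasure ν] {E : Set Ω} (hE : MeasurableSet E) :
    (μ ⊔ ν) E = sSup {r : ℝ≥0∞ | ∃ E₁ E₂ : Set Ω, MeasurableSet E₁ ∧ MeasurableSet E₂ ∧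
      Disjoint E₁ E₂ ∧ E₁ ∪ E₂ = E ∧ r = μ E₁ + ν E₂} := by
  apply le_antisymm
  · obtain ⟨s, hs, h1, h2⟩ := hahn_decomposition μ ν
    have key : μ ⊔ ν ≤ μ.restrict s + ν.restrict sᶜ := by
      refine sup_le ?_ ?_
      · refine Measure.le_iff.2 fun t ht => ?_
        rw [Measure.add_apply, Measure.restrict_apply ht, Measure.restrict_apply ht,
          ← measure_inter_add_sdiff t hs]
        exact add_le_add le_rfl (h2 _ (ht.diff hs) (fun x hx => hx.2))
      · refine Measure.le_iff.2 fun t ht => ?_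
        rw [Measure.add_apply, Measure.restrict_apply ht, Measure.restrict_apply ht,
          ← measure_inter_add_sdiff t hs]
        exact add_le_add (h1 _ (ht.inter hs) (fun x hx => hx.2)) le_rfl
    refine (key E).trans ?_
    rw [Measure.add_apply, Measure.restrict_apply hE, Measure.restrict_apply hE]
    refine le_sSup ⟨E ∩ s, E ∩ sᶜ, hE.inter hs, hE.inter hs.compl, ?_, ?_, rfl⟩
    · exact disjoint_compl_right.mono inter_subset_right inter_subset_right
    · exact inter_union_compl E s
  · refine sSup_le ?_
    rintro r ⟨E₁, E₂, -, h₂, hd, rfl, rfl⟩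
    rw [measure_union hd h₂]
    exact add_le_add ((le_sup_left : μ ≤ μ ⊔ ν) E₁) ((le_sup_right : ν ≤ μ ⊔ ν) E₂)

variable {Ω : Type*} [TopologicalSpace Ω] [T2Space Ω] [MeasurableSpace Ω] [BorelSpace Ω]

theorem regular_of_le_regular {m m' : Measure Ω} [IsFiniteMeasure m'] [m'.Regular]
    (h : m ≤ m') : m.Regular := by
  have hm : IsFiniteMeasure m := isFiniteMeasure_of_le m' h
  have ho : m.OuterRegular := by
    constructor
    intro A hA r hr
    obtain ⟨U, hAU, hU, -, hd⟩ := hA.exists_isOpen_sdiff_lt (measure_ne_top m' A)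
      (tsub_pos_of_lt hr).ne'
    refine ⟨U, hAU, hU, ?_⟩
    calc m U = m (U ∩ A) + m (U \ A) := (measure_inter_add_sdiff U hA).symm
      _ ≤ m A + m' (U \ A) := add_le_add (measure_mono inter_subset_right) (h _)
      _ < m A + (r - m A) := ENNReal.add_lt_add_left (measure_ne_top m A) hd
      _ = r := add_tsub_cancel_of_le hr.le
  refine ⟨?_⟩
  intro U hU r hr
  obtain ⟨K, hKU, hK, hd⟩ := hU.measurableSet.exists_isCompact_sdiff_lt (measure_ne_top m' U)
    (tsub_pos_of_lt hr).ne'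
  refine ⟨K, hKU, hK, ?_⟩
  by_contra hle
  have : m U < m U := calc
      m U = m (U ∩ K) + m (U \ K) := (measure_inter_add_sdiff U hK.measurableSet).symm
      _ ≤ r + m' (U \ K) :=
        add_le_add ((measure_mono inter_subset_right).trans (not_lt.1 hle)) (h _)
      _ < r + (m U - r) := ENNReal.add_lt_add_left (hr.ne_top) hd
      _ = m U := add_tsub_cancel_of_le hr.le
  exact lt_irrefl _ this

theorem regular_add_of_isFiniteMeasure {m m' : Measure Ω} [IsFiniteMeasure m] [IsFiniteMeasure m']
    [m.Regular] [m'.Regular] : (m + m').Regular := inferInstance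

end Aux

/-! ### The Banach space `M(Ω)` -/

section RegMeasure

/-- The linear space of complex regular Borel measures on `Ω`: those complex measures whose total
variation is a regular positive measure. -/
def regularComplexMeasures (Ω : Type*) [TopologicalSpace Ω] [T2Space Ω] [MeasurableSpace Ω]
    [BorelSpace Ω] : Submodule ℂ (ComplexMeasure Ω) where
  carrier := {μ | μ.variation.Regular}
  zero_mem' := by
    simp only [mem_ofPred_eq, VectorMeasure.variation_zero]
    infer_instance
  add_mem' := by
    intro μ ν hμ hν
    simp only [mem_ofPred_eq] at hμ hν ⊢
    have := regular_add_of_isFiniteMeasure (m := μ.variation) (m' := ν.variation)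
    exact regular_of_le_regular VectorMeasure.variation_add_le
  smul_mem' := by
    intro c μ hμ
    simp only [mem_ofPred_eq] at hμ ⊢
    rw [VectorMeasure.variation_smul]
    infer_instance

/-- `M(Ω)`. -/
abbrev RegMeasure (Ω : Type*) [TopologicalSpace Ω] [T2Space Ω] [MeasurableSpace Ω]
    [BorelSpace Ω] : Type _ := ↥(regularComplexMeasures Ω)

variable {Ω : Type*} [TopologicalSpace Ω] [T2Space Ω] [MeasurableSpace Ω] [BorelSpace Ω]

/-- The total variation measure `|μ|`. -/
def RegMeasure.abs (μ : RegMeasure Ω) : Measure Ω := (μ : ComplexMeasure Ω).variation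

instance (μ : RegMeasure Ω) : IsFiniteMeasure μ.abs :=
  isFiniteMeasure_variation_complexMeasure _

instance (μ : RegMeasure Ω) : μ.abs.Regular := μ.2

/-- The total variation norm `‖μ‖ = |μ|(Ω)`. -/
instance : NormedAddCommGroup (RegMeasure Ω) :=
  AddGroupNorm.toNormedAddCommGroup
    { toFun := fun μ => (μ.abs univ).toReal
      map_zero' := by simp [RegMeasure.abs]
      add_le' := by
        intro μ ν
        rw [← ENNReal.toReal_add (measure_ne_top _ _) (measure_ne_top _ _)]
        refine ENNReal.toReal_mono
          (ENNReal.add_ne_top.2 ⟨measure_ne_top _ _, measure_ne_top _ _⟩) ?_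
        exact (VectorMeasure.variation_add_le (μ := (μ : ComplexMeasure Ω)) (ν := ν)) univ
      neg' := by
        intro μ
        simp [RegMeasure.abs, VectorMeasure.variation_neg]
      eq_zero_of_map_eq_zero' := by
        intro μ h
        have h0 : μ.abs univ = 0 :=
          ((ENNReal.toReal_eq_zero_iff _).1 h).resolve_right (measure_ne_top _ _)
        exact Subtype.ext (VectorMeasure.variation_eq_zero.1 (Measure.measure_univ_eq_zero.1 h0)) }

theorem RegMeasure.norm_def (μ : RegMeasure Ω) : ‖μ‖ = (μ.abs univ).toReal := rfl

instance : NormedSpace ℂ (RegMeasure Ω) where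
  norm_smul_le c μ := by
    rw [RegMeasure.norm_def, RegMeasure.norm_def]
    apply le_of_eq
    have : (c • μ).abs = ‖c‖₊ • μ.abs := by
      simp only [RegMeasure.abs, Submodule.coe_smul]
      exact VectorMeasure.variation_smul
    rw [this, Measure.smul_apply, ENNReal.smul_def, smul_eq_mul, ENNReal.toReal_mul]
    simp

/-- The projection `P_X : M(Ω) → M(Ω)`, `P_X(μ)(E) = μ(X ∩ E)`, for a measurable set `X`
(for a set `X` that is not measurable it is the zero map). -/
def RegMeasure.proj (X : Set Ω) (μ : RegMeasure Ω) : RegMeasure Ω :=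
  ⟨(μ : ComplexMeasure Ω).restrict X,
    regular_of_le_regular (m' := μ.abs)
      ((VectorMeasure.variation_restrict_le).trans Measure.restrict_le_self)⟩

theorem RegMeasure.proj_apply {X : Set Ω} (hX : MeasurableSet X) (μ : RegMeasure Ω) {E : Set Ω}
    (hE : MeasurableSet E) :
    (μ.proj X : ComplexMeasure Ω) E = (μ : ComplexMeasure Ω) (X ∩ E) := by
  rw [inter_comm]
  exact VectorMeasure.restrict_apply _ hX hE

end RegMeasure

/-- `(X_1, …, X_n)` is a measurable partition of `Ω`: pairwise disjoint measurable sets with union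
`Ω`. As usual for ordered measurable partitions, some of the sets may be empty. -/
structure IsMeasurablePartition {Ω : Type*} [MeasurableSpace Ω] {n : ℕ} (X : Fin n → Set Ω) :
    Prop where
  measurableSet : ∀ i, MeasurableSet (X i)
  disjoint : Pairwise fun i j => Disjoint (X i) (X j)
  iUnion_eq : ⋃ i, X i = univ

end

/-! Both parts reduce to simple tuples. All `μ i` have densities with respect to `m = ∑ |μ i|`;
approximating the `ℂⁿ`-valued density in `L¹(m)` by a simple function `g` replaces `μ` by `∑ v, v •
σ_v`, where `σ_v` is the restriction of `m` to the fiber of `g` over `v`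
(`exists_simpleTuple_norm_sub_le`). The quantities compared are Lipschitz in the coordinates, so the
error is harmless.

(1) The axioms give `N (v • σ) ≤ ‖v‖ * ‖σ‖` for every multi-norm `N`, with the sup norm of `v`
(`smul_const_le`). Hence `N` of a simple tuple is at most `∑ ‖v‖ * ‖σ_v‖`. The lattice supremum has
at least this mass: over each `v`, keep a coordinate of largest modulus.

(2) The constraint on `φ` means `∑ ‖φ i e‖ ≤ ‖e‖` for all `e`. A partition yields such a `φ` from
norming functionals composed with the projections. Conversely, for a simple tuple `‖φ i (μ i)‖ ≤ ∑
v, ‖v i‖ * ‖σ_v‖ * t v i`, with `t v i = ‖φ i σ_v‖ / ‖σ_v‖` and `∑ i, t v i ≤ 1`. The sum of `q`-th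
powers of the right sides is convex in `t`, so it is bounded by its value at some vertex of a
product of simplices. A vertex assigns each fiber to one index, which is a measurable partition. -/

theorem ComplexMeasure.withDensityᵥ_rnDeriv_eq {Ω : Type*} [MeasurableSpace Ω]
    (c : ComplexMeasure Ω) (m : Measure Ω)
    [SigmaFinite m] (h : c ≪ᵥ m.toENNRealVectorMeasure) : m.withDensityᵥ (c.rnDeriv m) = c := by
  obtain ⟨h1, h2⟩ := (ComplexMeasure.absolutelyContinuous_ennreal_iff c _).1 h
  have hi := c.integrable_rnDeriv m
  have h1' := SignedMeasure.withDensityᵥ_rnDeriv_eq _ _ h1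
  have h2' := SignedMeasure.withDensityᵥ_rnDeriv_eq _ _ h2
  ext E hE
  rw [withDensityᵥ_apply hi hE]
  apply Complex.ext
  · rw [← RCLike.re_eq_complex_re, ← integral_re hi.integrableOn]
    have := congrArg (fun s : SignedMeasure Ω => s E) h1'
    beta_reduce at this
    rw [withDensityᵥ_apply (SignedMeasure.integrable_rnDeriv _ _) hE] at this
    exact this
  · rw [← RCLike.im_eq_complex_im, ← integral_im hi.integrableOn]
    have := congrArg (fun s : SignedMeasure Ω => s E) h2'
    beta_reduce at this
    rw [withDensityᵥ_apply (SignedMeasure.integrable_rnDeriv _ _) hE] at this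
    exact this

/-! ### Restriction of regular complex measures -/

section RegMeasureBasic

variable {Ω : Type*} [TopologicalSpace Ω] [T2Space Ω] [MeasurableSpace Ω] [BorelSpace Ω]

namespace RegMeasure

theorem norm_eq_real (μ : RegMeasure Ω) : ‖μ‖ = μ.abs.real univ := rfl

theorem abs_add_le (μ ν : RegMeasure Ω) : (μ + ν).abs ≤ μ.abs + ν.abs :=
  VectorMeasure.variation_add_le (μ := (μ : ComplexMeasure Ω)) (ν := ν)

theorem abs_smul (c : ℂ) (μ : RegMeasure Ω) : (c • μ).abs = ‖c‖₊ • μ.abs :=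
  VectorMeasure.variation_smul (μ := (μ : ComplexMeasure Ω)) (c := c)

@[simp]
theorem abs_zero : (0 : RegMeasure Ω).abs = 0 := by
  simp [RegMeasure.abs]

theorem abs_eq_zero {μ : RegMeasure Ω} : μ.abs = 0 ↔ μ = 0 := by
  refine ⟨fun h => Subtype.ext (VectorMeasure.variation_eq_zero.1 h), ?_⟩
  rintro rfl
  exact abs_zero

theorem abs_proj {X : Set Ω} (hX : MeasurableSet X) (μ : RegMeasure Ω) :
    (μ.proj X).abs = μ.abs.restrict X :=
  VectorMeasure.variation_restrict hX

theorem norm_proj {X : Set Ω} (hX : MeasurableSet X) (μ : RegMeasure Ω) :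
    ‖μ.proj X‖ = μ.abs.real X := by
  rw [norm_eq_real, abs_proj hX, measureReal_restrict_apply MeasurableSet.univ, univ_inter]

theorem norm_proj_le {X : Set Ω} (hX : MeasurableSet X) (μ : RegMeasure Ω) : ‖μ.proj X‖ ≤ ‖μ‖ := by
  rw [norm_proj hX, norm_eq_real]
  exact measureReal_mono (subset_univ _)

/-- The projection `P_X` as a continuous linear map. -/
noncomputable def projL {X : Set Ω} (hX : MeasurableSet X) : RegMeasure Ω →L[ℂ] RegMeasure Ω :=
  LinearMap.mkContinuous
    { toFun := RegMeasure.proj X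
      map_add' := fun _ _ => Subtype.ext (VectorMeasure.restrict_add _ _ X)
      map_smul' := fun _ _ => Subtype.ext (VectorMeasure.restrict_smul _) }
    1 fun μ => by simpa using norm_proj_le hX μ

@[simp]
theorem projL_apply {X : Set Ω} (hX : MeasurableSet X) (μ : RegMeasure Ω) :
    projL hX μ = μ.proj X := rfl

theorem proj_proj {X Y : Set Ω} (hX : MeasurableSet X) (hY : MeasurableSet Y) (μ : RegMeasure Ω) :
    (μ.proj X).proj Y = μ.proj (X ∩ Y) := by
  refine Subtype.ext (VectorMeasure.ext fun E hE => ?_)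
  rw [proj_apply hY _ hE, proj_apply hX _ (hY.inter hE), proj_apply (hX.inter hY) _ hE, inter_assoc]

theorem proj_empty (μ : RegMeasure Ω) : μ.proj ∅ = 0 := by
  rw [← norm_eq_zero, norm_proj MeasurableSet.empty, measureReal_empty]

/-- A measurable partition splits the total variation. -/
theorem sum_norm_proj {ι : Type*} (s : Finset ι) {X : ι → Set Ω}
    (hX : ∀ i ∈ s, MeasurableSet (X i)) (hd : (s : Set ι).PairwiseDisjoint X) (μ : RegMeasure Ω) :
    ∑ i ∈ s, ‖μ.proj (X i)‖ = μ.abs.real (⋃ i ∈ s, X i) := by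
  rw [measureReal_biUnion_finset hd hX]
  exact Finset.sum_congr rfl fun i hi => norm_proj (hX i hi) μ

end RegMeasure

/-! ### Densities and approximation by simple tuples -/

theorem norm_withDensityᵥ_le {m : Measure Ω} {f : Ω → ℂ} (hf : Integrable f m) (ν : RegMeasure Ω)
    (hν : (ν : ComplexMeasure Ω) = m.withDensityᵥ f) : ‖ν‖ ≤ (eLpNorm f 1 m).toReal := by
  have h : ν.abs ≤ m.withDensity fun x => ‖f x‖ₑ := by
    refine VectorMeasure.variation_le_of_forall_enorm_le fun E hE => ?_
    rw [hν, withDensityᵥ_apply hf hE, withDensity_apply _ hE]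
    exact enorm_integral_le_lintegral_enorm _
  rw [RegMeasure.norm_def, eLpNorm_one_eq_lintegral_enorm]
  refine ENNReal.toReal_mono hf.2.ne ((h univ).trans ?_)
  rw [withDensity_apply _ MeasurableSet.univ, Measure.restrict_univ]

/-- A finite regular positive measure, as an element of `M(Ω)`. -/
noncomputable def RegMeasure.ofMeasure (m : Measure Ω) [IsFiniteMeasure m] [m.Regular] :
    RegMeasure Ω :=
  ⟨m.withDensityᵥ fun _ => (1 : ℂ), regular_of_le_regular (m' := m) <| by
    refine VectorMeasure.variation_le_of_forall_enorm_le fun E hE => ?_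
    rw [withDensityᵥ_apply (integrable_const _) hE]
    refine (enorm_integral_le_lintegral_enorm _).trans ?_
    simp⟩

theorem RegMeasure.ofMeasure_apply (m : Measure Ω) [IsFiniteMeasure m] [m.Regular] {E : Set Ω}
    (hE : MeasurableSet E) : (RegMeasure.ofMeasure m : ComplexMeasure Ω) E = m.real E := by
  rw [RegMeasure.ofMeasure, withDensityᵥ_apply (integrable_const _) hE]
  simp

/-- The combination `∑ v_i P_{g⁻¹(v)} ρ`, i.e. the `i`-th coordinate of the simple function `g`
times `ρ`. -/
noncomputable def simpleTuple {n : ℕ} (g : SimpleFunc Ω (Fin n → ℂ)) (ρ : RegMeasure Ω)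
    (i : Fin n) : RegMeasure Ω :=
  ∑ v ∈ g.range, v i • ρ.proj (g ⁻¹' {v})

/-- Finitely many regular measures are simultaneously approximated by simple multiples of one. -/
theorem exists_simpleTuple_norm_sub_le {n : ℕ} (μ : Fin n → RegMeasure Ω) {ε : ℝ} (hε : 0 < ε) :
    ∃ (g : SimpleFunc Ω (Fin n → ℂ)) (ρ : RegMeasure Ω), ∀ i, ‖μ i - simpleTuple g ρ i‖ ≤ ε := by
  classical
  let m : Measure Ω := ∑ i, (μ i).abs
  have hreg : m.Regular := by
    refine Finset.sum_induction (fun i => (μ i).abs)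
      (fun m : Measure Ω => m.Regular ∧ IsFiniteMeasure m) ?_ ⟨inferInstance, inferInstance⟩
      (fun i _ => ⟨inferInstance, inferInstance⟩) |>.1
    rintro a b ⟨ha, ha'⟩ ⟨hb, hb'⟩
    exact ⟨inferInstance, inferInstance⟩
  have hfin : IsFiniteMeasure m := inferInstance
  have hac : ∀ i, (μ i : ComplexMeasure Ω) ≪ᵥ m.toENNRealVectorMeasure := by
    intro i
    refine VectorMeasure.AbsolutelyContinuous.mk fun E hE h0 => ?_
    rw [Measure.toENNRealVectorMeasure_apply_measurable hE] at h0
    have h1 : (μ i).abs E ≤ m E :=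
      (Finset.single_le_sum (f := fun i => (μ i).abs) (fun _ _ => Measure.zero_le _)
        (Finset.mem_univ i)) E
    have h2 := VectorMeasure.enorm_measure_le_variation (μ i : ComplexMeasure Ω) E
    rw [← enorm_eq_zero]
    exact le_antisymm (h2.trans (h1.trans h0.le)) zero_le
  -- Approximating the joint density, not each coordinate, gives one family of fibers that serves
  -- all indices.
  let f : Ω → Fin n → ℂ := fun x i => (μ i : ComplexMeasure Ω).rnDeriv m x
  have hfi : ∀ i, Integrable (fun x => f x i) m := fun i =>
    ComplexMeasure.integrable_rnDeriv _ _
  have hf : Integrable f m := Integrable.of_eval hfi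
  obtain ⟨g, hg, hgm⟩ := (memLp_one_iff_integrable.2 hf).exists_simpleFunc_eLpNorm_sub_lt
    ENNReal.one_ne_top (ENNReal.ofReal_pos.2 hε).ne'
  have hgi : Integrable g m := memLp_one_iff_integrable.1 hgm
  refine ⟨g, RegMeasure.ofMeasure m, fun i => ?_⟩
  have hgi' : Integrable (fun x => g x i) m := hgi.eval i
  have hs : (simpleTuple g (RegMeasure.ofMeasure m) i : ComplexMeasure Ω)
      = m.withDensityᵥ fun x => g x i := by
    ext E hE
    rw [withDensityᵥ_apply hgi' hE]
    have h2 : ∫ x in E, g x i ∂m = ∑ v ∈ g.range, (m.restrict E).real (g ⁻¹' {v}) • v i := by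
      have h3 := SimpleFunc.integral_eq_sum g (hgi.restrict (s := E))
      rw [← eval_integral fun j => (hgi.restrict (s := E)).eval j, h3, Finset.sum_apply]
      rfl
    rw [h2, simpleTuple, Submodule.coe_sum, FunLike.coe_sum,
      Finset.sum_apply]
    refine Finset.sum_congr rfl fun v _ => ?_
    have hv := g.measurableSet_preimage {v}
    change v i • ((RegMeasure.ofMeasure m).proj (g ⁻¹' {v}) : ComplexMeasure Ω) E = _
    rw [RegMeasure.proj_apply hv _ hE, RegMeasure.ofMeasure_apply m (hv.inter hE),
      measureReal_restrict_apply hv, smul_eq_mul, mul_comm, Complex.real_smul]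
  have hsub : ((μ i - simpleTuple g (RegMeasure.ofMeasure m) i : RegMeasure Ω) : ComplexMeasure Ω)
      = m.withDensityᵥ fun x => f x i - g x i := by
    rw [withDensityᵥ_sub' (hfi i) hgi', ← hs]
    change _ - _ = _ - _
    rw [ComplexMeasure.withDensityᵥ_rnDeriv_eq _ _ (hac i)]
  refine (norm_withDensityᵥ_le ((hfi i).sub hgi') _ hsub).trans ?_
  refine ENNReal.toReal_le_of_le_ofReal hε.le (le_trans ?_ hg.le)
  refine eLpNorm_mono fun x => ?_
  exact norm_le_pi_norm (f x - g x) i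

end RegMeasureBasic

/-! ### General multi-norms -/

section MultiNormBasic

variable {E : Type*} [NormedAddCommGroup E] [NormedSpace ℂ E]
  {N : (n : ℕ) → (Fin n → E) → ℝ}

namespace IsMultiNorm

theorem const (hN : IsMultiNorm N) (n : ℕ) (x : E) : N (n + 1) (fun _ => x) = ‖x‖ := by
  induction n with
  | zero => exact hN.one x
  | succ n ih =>
    rw [← ih, ← hN.snoc_last n fun _ => x]
    congr 1
    ext i
    refine Fin.lastCases ?_ (fun j => ?_) i <;> simp

/-- A tuple of multiples of one vector is a diagonal operator applied to a constant tuple. The case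
`n = 1` is separate because the axiom `smul_le` starts at `n = 2`. -/
theorem smul_const_le (hN : IsMultiNorm N) {n : ℕ} (hn : 1 ≤ n) (a : Fin n → ℂ) (x : E) :
    N n (fun i => a i • x) ≤ ‖a‖ * ‖x‖ := by
  obtain ⟨n, rfl⟩ := Nat.exists_eq_add_of_le' hn
  rcases Nat.eq_zero_or_pos n with rfl | h
  · have h0 : (fun i => a i • x) = fun _ : Fin 1 => a 0 • x := by
      ext i
      obtain rfl : i = 0 := Fin.fin_one_eq_zero i
      rfl
    rw [h0, hN.one, norm_smul]
    gcongr
    exact norm_le_pi_norm a 0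
  · rw [← hN.const n x]
    exact hN.smul_le _ (by omega) a _

theorem zero (hN : IsMultiNorm N) {n : ℕ} (hn : 1 ≤ n) : N n 0 = 0 := by
  have := hN.smul n hn 0 0
  simpa using this

theorem sum_le (hN : IsMultiNorm N) {n : ℕ} (hn : 1 ≤ n) {ι : Type*} (s : Finset ι)
    (f : ι → Fin n → E) : N n (∑ j ∈ s, f j) ≤ ∑ j ∈ s, N n (f j) :=
  Finset.le_sum_of_subadditive (N n) (hN.zero hn).le (hN.add_le n hn) s f

theorem le_sum_norm (hN : IsMultiNorm N) {n : ℕ} (hn : 1 ≤ n) (x : Fin n → E) :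
    N n x ≤ ∑ i, ‖x i‖ := by
  have hx : x = ∑ i, fun j => (Pi.single i 1 : Fin n → ℂ) j • x i := by
    ext j
    rw [Finset.sum_apply, Finset.sum_eq_single j] <;> simp +contextual [eq_comm]
  conv_lhs => rw [hx]
  refine (hN.sum_le hn _ _).trans (Finset.sum_le_sum fun i _ => ?_)
  refine (hN.smul_const_le hn _ _).trans (mul_le_of_le_one_left (norm_nonneg _) ?_)
  rw [Pi.norm_single, norm_one]

/-- This Lipschitz bound permits the passage to simple tuples, for every multi-norm at once. -/
theorem le_add_sum_norm_sub (hN : IsMultiNorm N) {n : ℕ} (hn : 1 ≤ n) (x y : Fin n → E) :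
    N n x ≤ N n y + ∑ i, ‖x i - y i‖ := by
  have h := hN.add_le n hn y (x - y)
  rw [add_sub_cancel] at h
  exact h.trans (by gcongr; exact hN.le_sum_norm hn (x - y))

end IsMultiNorm

end MultiNormBasic

/-! ### Simple tuples restricted to a fiber -/

section SimpleTuple

variable {Ω : Type*} [TopologicalSpace Ω] [T2Space Ω] [MeasurableSpace Ω] [BorelSpace Ω]

theorem proj_simpleTuple {n : ℕ} (g : SimpleFunc Ω (Fin n → ℂ)) (ρ : RegMeasure Ω) (i : Fin n)
    {w : Fin n → ℂ} (hw : w ∈ g.range) :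
    (simpleTuple g ρ i).proj (g ⁻¹' {w}) = w i • ρ.proj (g ⁻¹' {w}) := by
  rw [← RegMeasure.projL_apply (g.measurableSet_preimage {w}), simpleTuple, map_sum,
    Finset.sum_eq_single w]
  · rw [map_smul, RegMeasure.projL_apply, RegMeasure.proj_proj (g.measurableSet_preimage {w})
      (g.measurableSet_preimage {w}), inter_self]
  · intro v _ hvw
    have h : g ⁻¹' {v} ∩ g ⁻¹' {w} = ∅ := by
      rw [← preimage_inter, singleton_inter_eq_empty.2 (by simpa using hvw), preimage_empty]
    rw [map_smul, RegMeasure.projL_apply, RegMeasure.proj_proj (g.measurableSet_preimage {v})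
      (g.measurableSet_preimage {w}), h, RegMeasure.proj_empty, smul_zero]
  · exact fun h => absurd hw h

theorem abs_simpleTuple_real {n : ℕ} (g : SimpleFunc Ω (Fin n → ℂ)) (ρ : RegMeasure Ω) (i : Fin n)
    {w : Fin n → ℂ} (hw : w ∈ g.range) :
    (simpleTuple g ρ i).abs.real (g ⁻¹' {w}) = ‖w i‖ * ‖ρ.proj (g ⁻¹' {w})‖ := by
  rw [← RegMeasure.norm_proj (g.measurableSet_preimage {w}), proj_simpleTuple g ρ i hw, norm_smul]

end SimpleTuple

/-! ### The multi-norm `‖|μ_1| ∨ ⋯ ∨ |μ_n|‖` -/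

section LatticeMultiNorm

variable {Ω : Type*} [TopologicalSpace Ω] [T2Space Ω] [MeasurableSpace Ω] [BorelSpace Ω]

theorem iSup_abs_le_sum {n : ℕ} (μ : Fin n → RegMeasure Ω) : ⨆ i, (μ i).abs ≤ ∑ i, (μ i).abs :=
  iSup_le fun i => Finset.single_le_sum (f := fun i => (μ i).abs)
    (fun _ _ => Measure.zero_le _) (Finset.mem_univ i)

instance isFiniteMeasure_iSup_abs {n : ℕ} (μ : Fin n → RegMeasure Ω) :
    IsFiniteMeasure (⨆ i, (μ i).abs) :=
  isFiniteMeasure_of_le _ (iSup_abs_le_sum μ)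

theorem toReal_iSup_abs_le {n : ℕ} {μ : Fin n → RegMeasure Ω} {m : Measure Ω} [IsFiniteMeasure m]
    (h : ∀ i, (μ i).abs ≤ m) : ((⨆ i, (μ i).abs) univ).toReal ≤ (m univ).toReal :=
  ENNReal.toReal_mono (measure_ne_top _ _) ((iSup_le h : ⨆ i, (μ i).abs ≤ m) univ)

theorem toReal_smul_univ {Ω : Type*} [MeasurableSpace Ω] (c : ℝ≥0) (m : Measure Ω) :
    ((c • m) univ).toReal = c * (m univ).toReal := by
  rw [Measure.smul_apply, ENNReal.smul_def, smul_eq_mul, ENNReal.toReal_mul, ENNReal.coe_toReal]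

theorem toReal_iSup_abs_smul_le {n : ℕ} (α : Fin n → ℂ) (μ : Fin n → RegMeasure Ω) :
    ((⨆ i, (α i • μ i).abs) univ).toReal ≤ ‖α‖ * ((⨆ i, (μ i).abs) univ).toReal := by
  rw [← coe_nnnorm, ← toReal_smul_univ]
  refine toReal_iSup_abs_le (μ := fun i => α i • μ i) fun i => ?_
  rw [RegMeasure.abs_smul]
  refine Measure.le_iff.2 fun E _ => ?_
  rw [Measure.smul_apply, Measure.smul_apply, ENNReal.smul_def, ENNReal.smul_def, smul_eq_mul,
    smul_eq_mul]
  exact mul_le_mul' (ENNReal.coe_le_coe.2 (nnnorm_le_pi_nnnorm α i))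
    (le_iSup (fun i => (μ i).abs) i E)

theorem isMultiNorm_toReal_iSup_abs :
    IsMultiNorm (E := RegMeasure Ω) fun _ μ => ((⨆ i, (μ i).abs) univ).toReal where
  add_le n _ μ ν := by
    rw [← ENNReal.toReal_add (measure_ne_top _ _) (measure_ne_top _ _), ← Measure.add_apply]
    refine toReal_iSup_abs_le (μ := μ + ν) fun i => ?_
    exact (RegMeasure.abs_add_le _ _).trans
      (add_le_add (le_iSup (fun i => (μ i).abs) i) (le_iSup (fun i => (ν i).abs) i))
  smul n hn c μ := by
    have : NeZero n := ⟨by omega⟩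
    -- Homogeneity follows from this inequality applied to both `c` and `c⁻¹`.
    have h (c : ℂ) (μ : Fin n → RegMeasure Ω) :
        ((⨆ i, ((c • μ) i).abs) univ).toReal ≤ ‖c‖ * ((⨆ i, (μ i).abs) univ).toReal := by
      refine (toReal_iSup_abs_smul_le (fun _ => c) μ).trans_eq ?_
      rw [Pi.norm_def, Finset.sup_const Finset.univ_nonempty, coe_nnnorm]
    refine le_antisymm (h c μ) ?_
    rcases eq_or_ne c 0 with rfl | hc
    · simp
    · have h1 := h c⁻¹ (c • μ)
      rw [inv_smul_smul₀ hc, norm_inv] at h1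
      rwa [le_inv_mul_iff₀ (norm_pos_iff.2 hc)] at h1
  eq_zero n _ μ h := by
    have h0 : ⨆ i, (μ i).abs = 0 :=
      Measure.measure_univ_eq_zero.1
        (((ENNReal.toReal_eq_zero_iff _).1 h).resolve_right (measure_ne_top _ _))
    ext1 i
    exact RegMeasure.abs_eq_zero.1
      (le_antisymm (h0 ▸ le_iSup (fun i => (μ i).abs) i) (Measure.zero_le _))
  one μ := by
    rw [ciSup_const, RegMeasure.norm_def]
  perm n _ σ μ := by
    rw [← Equiv.iSup_comp (g := fun i => (μ i).abs) σ]
    rfl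
  smul_le n _ α μ := toReal_iSup_abs_smul_le α μ
  snoc_zero n _ μ := by
    congr 2
    refine le_antisymm (iSup_le fun i => ?_) (iSup_le fun i => ?_)
    · refine Fin.lastCases ?_ (fun j => ?_) i
      · rw [Fin.snoc_last, RegMeasure.abs_zero]
        exact Measure.zero_le _
      · rw [Fin.snoc_castSucc]
        exact le_iSup (fun i => (μ i).abs) j
    · refine le_trans (le_of_eq ?_) (le_iSup _ i.castSucc)
      rw [Fin.snoc_castSucc]
  snoc_last n μ := by
    congr 2
    refine le_antisymm (iSup_le fun i => ?_) (iSup_le fun i => ?_)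
    · refine Fin.lastCases ?_ (fun j => ?_) i
      · rw [Fin.snoc_last]
        exact le_iSup (fun i => (μ i).abs) _
      · rw [Fin.snoc_castSucc]
        exact le_iSup (fun i => (μ i).abs) j
    · refine le_trans (le_of_eq ?_) (le_iSup _ i.castSucc)
      rw [Fin.snoc_castSucc]

/-- On the fiber over `v`, the supremum dominates the variation of the coordinate where `‖v i‖` is
largest, and the fibers are disjoint. -/
theorem sum_norm_mul_norm_proj_le {n : ℕ} (hn : 1 ≤ n) (g : SimpleFunc Ω (Fin n → ℂ))
    (ρ : RegMeasure Ω) :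
    ∑ v ∈ g.range, ‖v‖ * ‖ρ.proj (g ⁻¹' {v})‖ ≤
      ((⨆ i, (simpleTuple g ρ i).abs) univ).toReal := by
  have : NeZero n := ⟨by omega⟩
  have h (v : Fin n → ℂ) : ∃ i, ‖v‖ = ‖v i‖ := by
    obtain ⟨i, hi⟩ := Finite.exists_max fun i => ‖v i‖
    exact ⟨i, le_antisymm ((pi_norm_le_iff_of_nonneg (norm_nonneg _)).2 hi) (norm_le_pi_norm v i)⟩
  choose c hc using h
  calc ∑ v ∈ g.range, ‖v‖ * ‖ρ.proj (g ⁻¹' {v})‖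
      ≤ ∑ v ∈ g.range, (⨆ i, (simpleTuple g ρ i).abs).real (g ⁻¹' {v}) := by
        refine Finset.sum_le_sum fun v hv => ?_
        rw [hc v, ← abs_simpleTuple_real g ρ (c v) hv]
        exact ENNReal.toReal_mono (measure_ne_top _ _)
          (le_iSup (fun i => (simpleTuple g ρ i).abs) (c v) _)
    _ = (⨆ i, (simpleTuple g ρ i).abs).real (⋃ v ∈ g.range, g ⁻¹' {v}) :=
        (measureReal_biUnion_finset (pairwiseDisjoint_fiber g _)
          fun v _ => g.measurableSet_preimage {v}).symm
    _ ≤ _ := measureReal_mono (subset_univ _)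

theorem isMaximumMultiNorm_toReal_iSup_abs :
    IsMaximumMultiNorm (E := RegMeasure Ω) fun _ μ => ((⨆ i, (μ i).abs) univ).toReal := by
  have hM := isMultiNorm_toReal_iSup_abs (Ω := Ω)
  refine ⟨hM, fun N hN n hn μ => le_of_forall_pos_le_add fun ε hε => ?_⟩
  have hn0 : (0 : ℝ) < n := by exact_mod_cast hn
  -- The `n` coordinate errors add up to `ε / 2`, paid once for `N` and once for the lattice
  -- multi-norm.
  obtain ⟨g, ρ, h⟩ := exists_simpleTuple_norm_sub_le μ (ε := ε / (2 * n)) (by positivity)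
  have hsum : ∑ i, ‖μ i - simpleTuple g ρ i‖ ≤ ε / 2 := by
    refine (Finset.sum_le_sum fun i _ => h i).trans_eq ?_
    rw [Finset.sum_const, Finset.card_univ, Fintype.card_fin, nsmul_eq_mul]
    field_simp
  have hsum' : ∑ i, ‖simpleTuple g ρ i - μ i‖ ≤ ε / 2 := by
    simpa only [norm_sub_rev] using hsum
  have h1 := hN.le_add_sum_norm_sub hn μ (simpleTuple g ρ)
  have h2 := hM.le_add_sum_norm_sub hn (simpleTuple g ρ) μ
  have h3 : N n (simpleTuple g ρ) ≤ ∑ v ∈ g.range, ‖v‖ * ‖ρ.proj (g ⁻¹' {v})‖ := by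
    have he : simpleTuple g ρ = ∑ v ∈ g.range, fun i => v i • ρ.proj (g ⁻¹' {v}) := by
      ext1 i
      rw [Finset.sum_apply]
      rfl
    rw [he]
    exact (hN.sum_le hn _ _).trans (Finset.sum_le_sum fun v _ => hN.smul_const_le hn v _)
  have h4 := sum_norm_mul_norm_proj_le hn g ρ
  linarith

end LatticeMultiNorm

/-! ### The weak `1`-summing norm on a dual space -/

section WeakSumming

variable {E : Type*} [NormedAddCommGroup E] [NormedSpace ℂ E]

theorem sum_norm_apply_le_of_weakSummingNorm_le_one {n : ℕ} {φ : Fin n → StrongDual ℂ E}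
    (h : weakSummingNorm 1 φ ≤ 1) (e : E) : ∑ i, ‖φ i e‖ ≤ ‖e‖ := by
  rcases eq_or_ne e 0 with rfl | he
  · simp
  have he' : 0 < ‖e‖ := norm_pos_iff.2 he
  -- Boundedness is needed because a real `sSup` of an unbounded set is `0`.
  have hbdd : BddAbove {r : ℝ | ∃ Φ : StrongDual ℂ (StrongDual ℂ E), ‖Φ‖ ≤ 1 ∧
      r = (∑ i, ‖Φ (φ i)‖ ^ (1 : ℝ)) ^ (1 / (1 : ℝ))} := by
    refine ⟨∑ i, ‖φ i‖, ?_⟩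
    rintro r ⟨Φ, hΦ, rfl⟩
    simp only [Real.rpow_one, div_one]
    exact Finset.sum_le_sum fun i _ =>
      (Φ.le_opNorm _).trans (mul_le_of_le_one_left (norm_nonneg _) hΦ)
  have hle : (∑ i, ‖φ i e‖) / ‖e‖ ≤ weakSummingNorm 1 φ := by
    refine le_csSup hbdd ⟨((‖e‖⁻¹ : ℝ) : ℂ) • NormedSpace.inclusionInDoubleDual ℂ E e, ?_, ?_⟩
    · rw [norm_smul, Complex.norm_real, norm_inv, norm_norm]
      exact (mul_le_mul_of_nonneg_left (NormedSpace.double_dual_bound ℂ E e) (by positivity)).trans_eq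
        (inv_mul_cancel₀ he'.ne')
    · simp only [Real.rpow_one, div_one, smul_apply, NormedSpace.dual_def, norm_smul,
        Complex.norm_real, norm_inv, norm_norm, ← Finset.mul_sum]
      rw [div_eq_inv_mul]
  exact (div_le_one he').1 (hle.trans h)

/-- Unimodular `c i` turn `∑ ‖Φ (φ i)‖` into `Φ (∑ c i • φ i)`. The norm of this combination is
tested on `E` alone, so vectors of `E` suffice in place of the bidual. -/
theorem weakSummingNorm_le_one_of_sum_norm_apply_le {n : ℕ} {φ : Fin n → StrongDual ℂ E}
    (h : ∀ e, ∑ i, ‖φ i e‖ ≤ ‖e‖) : weakSummingNorm 1 φ ≤ 1 := by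
  refine csSup_le ⟨_, 0, by simp, rfl⟩ ?_
  rintro r ⟨Φ, hΦ, rfl⟩
  simp only [Real.rpow_one, div_one]
  choose c hc hcΦ using fun i => RCLike.exists_norm_eq_mul_self (Φ (φ i))
  have h1 : ((∑ i, ‖Φ (φ i)‖ : ℝ) : ℂ) = Φ (∑ i, c i • φ i) := by
    rw [map_sum, Complex.ofReal_sum]
    exact Finset.sum_congr rfl fun i _ => by rw [map_smul, smul_eq_mul, ← hcΦ]; rfl
  have h2 : ‖∑ i, c i • φ i‖ ≤ 1 := by
    refine ContinuousLinearMap.opNorm_le_bound _ zero_le_one fun e => ?_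
    rw [one_mul, sum_apply]
    refine (norm_sum_le _ _).trans (le_trans (le_of_eq ?_) (h e))
    exact Finset.sum_congr rfl fun i _ => by rw [smul_apply, norm_smul, hc, one_mul]
  have h3 := congrArg norm h1
  rw [Complex.norm_real, Real.norm_of_nonneg (Finset.sum_nonneg fun _ _ => norm_nonneg _)] at h3
  rw [h3]
  exact (Φ.le_opNorm _).trans (mul_le_one₀ hΦ (norm_nonneg _) h2)

end WeakSumming

/-! ### A convex function on a product of simplices -/

section Convex

theorem ConvexOn.fun_finset_sum {V ι : Type*} [AddCommGroup V] [Module ℝ V] {D : Set V}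
    (hD : Convex ℝ D) (s : Finset ι) {f : ι → V → ℝ} (hf : ∀ i ∈ s, ConvexOn ℝ D (f i)) :
    ConvexOn ℝ D fun x => ∑ i ∈ s, f i x := by
  have h := Finset.sum_induction f (ConvexOn ℝ D) (fun _ _ => ConvexOn.add) (convexOn_const 0 hD) hf
  exact h.congr fun x _ => Finset.sum_apply x s f

/-- A convex function on a convex hull is bounded at each point by its value at some generator; here
the generators are tuples of unit vectors. -/
theorem exists_choice_sum_rpow_le_of_stdSimplex {ι : Type*} [Fintype ι] {n : ℕ} {q : ℝ}
    (hq : 1 ≤ q) (b t : ι → Fin n → ℝ) (hb : ∀ j i, 0 ≤ b j i)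
    (ht : ∀ j, t j ∈ stdSimplex ℝ (Fin n)) :
    ∃ c : ι → Fin n, ∑ i, (∑ j, b j i * t j i) ^ q ≤
      ∑ i, (∑ j, if c j = i then b j i else 0) ^ q := by
  classical
  let S : Set (ι → Fin n → ℝ) := univ.pi fun _ => range fun i => Pi.single i 1
  -- Convexity of `x ^ q` is available for `x ≥ 0`, hence the restriction to the nonnegative
  -- orthant.
  let D : Set (ι → Fin n → ℝ) := {t | ∀ j i, 0 ≤ t j i}
  have hD : Convex ℝ D := by
    intro x hx y hy a a' ha ha' _ j i
    exact add_nonneg (mul_nonneg ha (hx j i)) (mul_nonneg ha' (hy j i))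
  have hconv : ConvexOn ℝ D fun t => ∑ i, (∑ j, b j i * t j i) ^ q := by
    refine ConvexOn.fun_finset_sum hD _ fun i _ => ?_
    let L : (ι → Fin n → ℝ) →ₗ[ℝ] ℝ :=
      ∑ j, b j i • ((LinearMap.proj i : (Fin n → ℝ) →ₗ[ℝ] ℝ) ∘ₗ LinearMap.proj j)
    have hL : ∀ t, L t = ∑ j, b j i * t j i := fun t => by simp [L]
    have h1 := (convexOn_rpow hq).comp_linearMap L
    refine (h1.subset ?_ hD).congr fun t _ => by simp [hL]
    intro t ht
    rw [mem_preimage, hL]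
    exact Finset.sum_nonneg fun j _ => mul_nonneg (hb j i) (ht j i)
  have hSD : S ⊆ D := by
    intro t ht j i
    obtain ⟨k, hk⟩ := ht j (mem_univ j)
    rw [← hk]
    exact (Pi.single_nonneg.2 zero_le_one : (0 : Fin n → ℝ) ≤ Pi.single k 1) i
  have htS : t ∈ convexHull ℝ S := by
    rw [convexHull_pi]
    intro j _
    rw [convexHull_rangle_single_eq_stdSimplex]
    exact ht j
  obtain ⟨y, hy, hle⟩ := hconv.exists_ge_of_mem_convexHull hSD htS
  choose c hc using fun j => hy j (mem_univ j)
  refine ⟨c, hle.trans_eq ?_⟩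
  refine Finset.sum_congr rfl fun i _ => ?_
  congr 1
  refine Finset.sum_congr rfl fun j _ => ?_
  rw [← hc j]
  simp [Pi.single_apply, eq_comm]

theorem exists_choice_sum_rpow_le {α : Type*} (s : Finset α) {n : ℕ} (hn : 1 ≤ n) {q : ℝ}
    (hq : 1 ≤ q) (b t : α → Fin n → ℝ) (hb : ∀ j i, 0 ≤ b j i) (ht : ∀ j i, 0 ≤ t j i)
    (ht1 : ∀ j, ∑ i, t j i ≤ 1) :
    ∃ c : α → Fin n, ∑ i, (∑ j ∈ s, b j i * t j i) ^ q ≤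
      ∑ i, (∑ j ∈ s, if c j = i then b j i else 0) ^ q := by
  classical
  have : NeZero n := ⟨by omega⟩
  -- The missing mass goes to coordinate `0`; as `b ≥ 0`, this can only increase the left side.
  let t' : α → Fin n → ℝ := fun j => t j + Pi.single 0 (1 - ∑ i, t j i)
  have htt' : ∀ j, t j ≤ t' j := fun j =>
    le_add_of_nonneg_right (Pi.single_nonneg.2 (sub_nonneg.2 (ht1 j)))
  obtain ⟨c, hc⟩ := exists_choice_sum_rpow_le_of_stdSimplex hq (fun j : s => b j) (fun j => t' j)
    (fun j => hb j) fun j => ⟨fun i => (ht j i).trans (htt' j i), by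
      simp [t', Finset.sum_add_distrib, Finset.sum_pi_single']⟩
  refine ⟨fun j => if h : j ∈ s then c ⟨j, h⟩ else 0, ?_⟩
  refine le_trans ?_ (hc.trans_eq ?_)
  · refine Finset.sum_le_sum fun i _ => ?_
    rw [Finset.sum_coe_sort s fun j => b j i * t' j i]
    refine Real.rpow_le_rpow (Finset.sum_nonneg fun j _ => mul_nonneg (hb j i) (ht j i))
      (Finset.sum_le_sum fun j _ => ?_) (by linarith)
    exact mul_le_mul_of_nonneg_left (htt' j i) (hb j i)
  · refine Finset.sum_congr rfl fun i _ => ?_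
    congr 1
    rw [← Finset.sum_coe_sort s]
    exact Finset.sum_congr rfl fun j _ => by simp

end Convex

/-! ### The weak `(1,q)`-multi-norm over `M(Ω)` -/

section WeakMultiNorm

variable {Ω : Type*} [TopologicalSpace Ω] [T2Space Ω] [MeasurableSpace Ω] [BorelSpace Ω]

theorem IsMeasurablePartition.sum_norm_proj {n : ℕ} {X : Fin n → Set Ω}
    (hX : IsMeasurablePartition X) (μ : RegMeasure Ω) : ∑ i, ‖μ.proj (X i)‖ = ‖μ‖ := by
  rw [RegMeasure.sum_norm_proj _ (fun i _ => hX.measurableSet i)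
    (fun i _ j _ h => hX.disjoint h), RegMeasure.norm_eq_real]
  simp [hX.iUnion_eq]

theorem isMeasurablePartition_fiber {Ω : Type*} [MeasurableSpace Ω] {n : ℕ} {α : Type*} (g : SimpleFunc Ω α) (c : α → Fin n) :
    IsMeasurablePartition fun i => g ⁻¹' (c ⁻¹' {i}) where
  measurableSet i := g.measurableSet_preimage _
  disjoint i j h := Disjoint.preimage g (Disjoint.preimage c (by simpa using h))
  iUnion_eq := by
    ext x
    simp

/-- Functionals realising `‖P_{X_i} μ_i‖` whose moduli sum to a contraction. -/
theorem IsMeasurablePartition.exists_dual {n : ℕ} {X : Fin n → Set Ω}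
    (hX : IsMeasurablePartition X) (μ : Fin n → RegMeasure Ω) :
    ∃ φ : Fin n → StrongDual ℂ (RegMeasure Ω), weakSummingNorm 1 φ ≤ 1 ∧
      ∀ i, ‖φ i (μ i)‖ = ‖(μ i).proj (X i)‖ := by
  choose ψ hψ hψμ using fun i => exists_dual_vector'' ℂ ((μ i).proj (X i))
  refine ⟨fun i => (ψ i).comp (RegMeasure.projL (hX.measurableSet i)),
    weakSummingNorm_le_one_of_sum_norm_apply_le fun ν => ?_, fun i => ?_⟩
  · rw [← hX.sum_norm_proj ν]
    exact Finset.sum_le_sum fun i _ =>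
      ((ψ i).le_opNorm _).trans (mul_le_of_le_one_left (norm_nonneg _) (hψ i))
  · rw [ContinuousLinearMap.comp_apply, RegMeasure.projL_apply, hψμ]
    simp

theorem exists_partition_sum_rpow_simpleTuple_le {n : ℕ} (hn : 1 ≤ n) {q : ℝ} (hq : 1 ≤ q)
    {φ : Fin n → StrongDual ℂ (RegMeasure Ω)} (hφ : ∀ ν, ∑ i, ‖φ i ν‖ ≤ ‖ν‖)
    (g : SimpleFunc Ω (Fin n → ℂ)) (ρ : RegMeasure Ω) :
    ∃ X : Fin n → Set Ω, IsMeasurablePartition X ∧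
      ∑ i, ‖φ i (simpleTuple g ρ i)‖ ^ q ≤ ∑ i, ‖(simpleTuple g ρ i).proj (X i)‖ ^ q := by
  classical
  let σ : (Fin n → ℂ) → RegMeasure Ω := fun v => ρ.proj (g ⁻¹' {v})
  have hq0 : 0 ≤ q := by linarith
  -- The weights are `0` when `σ v = 0`, by the convention for division by zero, so no fiber has to
  -- be excluded.
  obtain ⟨c, hc⟩ := exists_choice_sum_rpow_le g.range hn hq (fun v i => ‖v i‖ * ‖σ v‖)
    (fun v i => ‖φ i (σ v)‖ / ‖σ v‖) (fun v i => by positivity) (fun v i => by positivity)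
    (fun v => by
      rw [← Finset.sum_div]
      exact div_le_one_of_le₀ (hφ _) (norm_nonneg _))
  refine ⟨fun i => g ⁻¹' (c ⁻¹' {i}), isMeasurablePartition_fiber g c,
    le_trans (Finset.sum_le_sum fun i _ => ?_)
      (hc.trans (Finset.sum_le_sum fun i _ => ?_))⟩
  · refine Real.rpow_le_rpow (norm_nonneg _) ?_ hq0
    rw [simpleTuple, map_sum]
    refine (norm_sum_le _ _).trans (Finset.sum_le_sum fun v _ => ?_)
    rw [map_smul, norm_smul]
    change _ * ‖φ i (σ v)‖ ≤ _
    rcases eq_or_ne (σ v) 0 with h | h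
    · simp [h]
    · have := norm_ne_zero_iff.2 h
      apply le_of_eq
      field_simp
  · refine Real.rpow_le_rpow (Finset.sum_nonneg fun v _ => by positivity) ?_ hq0
    rw [← Finset.sum_filter, RegMeasure.norm_proj (g.measurableSet_preimage _)]
    calc ∑ v ∈ g.range with c v = i, ‖v i‖ * ‖σ v‖
        = ∑ v ∈ g.range with c v = i, (simpleTuple g ρ i).abs.real (g ⁻¹' {v}) :=
          Finset.sum_congr rfl fun v hv =>
            (abs_simpleTuple_real g ρ i (Finset.mem_filter.1 hv).1).symm
      _ = (simpleTuple g ρ i).abs.real (⋃ v ∈ g.range.filter fun v => c v = i, g ⁻¹' {v}) :=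
          (measureReal_biUnion_finset (pairwiseDisjoint_fiber g _)
            fun v _ => g.measurableSet_preimage {v}).symm
      _ ≤ _ := by
          refine measureReal_mono (iUnion₂_subset fun v hv => preimage_mono ?_)
          exact singleton_subset_iff.2 (Finset.mem_filter.1 hv).2

/-- Minkowski's inequality; the last term is the `ℓ^q` norm of the constant tuple `ε`. -/
theorem rpow_sum_le_add_of_le_add {n : ℕ} {q ε : ℝ} (hq : 1 ≤ q) (hε : 0 ≤ ε) {x y : Fin n → ℝ}
    (hx : ∀ i, 0 ≤ x i) (hy : ∀ i, 0 ≤ y i) (h : ∀ i, x i ≤ y i + ε) :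
    (∑ i, x i ^ q) ^ (1 / q) ≤ (∑ i, y i ^ q) ^ (1 / q) + (n : ℝ) ^ (1 / q) * ε := by
  have hq0 : 0 < q := by linarith
  have h1 : (∑ i, x i ^ q) ^ (1 / q) ≤ (∑ i, (y i + ε) ^ q) ^ (1 / q) :=
    Real.rpow_le_rpow (Finset.sum_nonneg fun i _ => Real.rpow_nonneg (hx i) q)
      (Finset.sum_le_sum fun i _ => Real.rpow_le_rpow (hx i) (h i) hq0.le) (by positivity)
  have h2 := Real.Lp_add_le_of_nonneg (Finset.univ : Finset (Fin n)) (f := y) (g := fun _ => ε) hq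
    (fun i _ => hy i) (fun _ _ => hε)
  have h3 : (∑ _i : Fin n, ε ^ q) ^ (1 / q) = (n : ℝ) ^ (1 / q) * ε := by
    rw [Finset.sum_const, Finset.card_univ, Fintype.card_fin, nsmul_eq_mul,
      Real.mul_rpow (by positivity) (by positivity), one_div, Real.rpow_rpow_inv hε hq0.ne']
  linarith

theorem rpow_sum_norm_apply_le_of_forall_partition {n : ℕ} (hn : 1 ≤ n) {q : ℝ} (hq : 1 ≤ q)
    {φ : Fin n → StrongDual ℂ (RegMeasure Ω)} (hφ : ∀ ν, ∑ i, ‖φ i ν‖ ≤ ‖ν‖)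
    {μ : Fin n → RegMeasure Ω} {B : ℝ}
    (hB : ∀ X : Fin n → Set Ω, IsMeasurablePartition X →
      (∑ i, ‖(μ i).proj (X i)‖ ^ q) ^ (1 / q) ≤ B) :
    (∑ i, ‖φ i (μ i)‖ ^ q) ^ (1 / q) ≤ B := by
  refine le_of_forall_pos_le_add fun ε hε => ?_
  have hn0 : (0 : ℝ) < n := by exact_mod_cast hn
  have hc : 0 < (n : ℝ) ^ (1 / q) := Real.rpow_pos_of_pos hn0 _
  -- The error `n ^ (1 / q) * δ = ε / 2` occurs twice: in replacing `μ` by the simple tuple under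
  -- `φ`, and in returning to `μ` under the projections. Both maps are contractive in each
  -- coordinate.
  set δ := ε / (2 * (n : ℝ) ^ (1 / q)) with hδ
  have hδ0 : 0 < δ := by positivity
  obtain ⟨g, ρ, h⟩ := exists_simpleTuple_norm_sub_le μ hδ0
  obtain ⟨X, hX, hle⟩ := exists_partition_sum_rpow_simpleTuple_le hn hq hφ g ρ
  have h1 := rpow_sum_le_add_of_le_add hq hδ0.le (x := fun i => ‖φ i (μ i)‖)
    (y := fun i => ‖φ i (simpleTuple g ρ i)‖) (fun _ => norm_nonneg _) (fun _ => norm_nonneg _)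
    fun i => by
      have h2 : ‖φ i (μ i - simpleTuple g ρ i)‖ ≤ δ :=
        ((Finset.single_le_sum (f := fun i => ‖φ i (μ _ - simpleTuple g ρ _)‖)
          (fun _ _ => norm_nonneg _) (Finset.mem_univ i)).trans (hφ _)).trans (h i)
      rw [map_sub] at h2
      linarith [norm_sub_norm_le (φ i (μ i)) (φ i (simpleTuple g ρ i))]
  have h3 := rpow_sum_le_add_of_le_add hq hδ0.le (x := fun i => ‖(simpleTuple g ρ i).proj (X i)‖)
    (y := fun i => ‖(μ i).proj (X i)‖) (fun _ => norm_nonneg _) (fun _ => norm_nonneg _)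
    fun i => by
      have h2 := (RegMeasure.norm_proj_le (hX.measurableSet i) _).trans (h i)
      rw [← RegMeasure.projL_apply (hX.measurableSet i), map_sub, RegMeasure.projL_apply,
        RegMeasure.projL_apply, norm_sub_rev] at h2
      linarith [norm_sub_norm_le ((simpleTuple g ρ i).proj (X i)) ((μ i).proj (X i))]
  have h4 : (∑ i, ‖φ i (simpleTuple g ρ i)‖ ^ q) ^ (1 / q) ≤
      (∑ i, ‖(simpleTuple g ρ i).proj (X i)‖ ^ q) ^ (1 / q) :=
    Real.rpow_le_rpow (Finset.sum_nonneg fun _ _ => by positivity) hle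
      (one_div_nonneg.2 (by linarith))
  have h5 : (n : ℝ) ^ (1 / q) * δ = ε / 2 := by
    rw [hδ]
    field_simp
  linarith [hB X hX]

theorem isLUB_weakMultiNorm_one {q : ℝ} (hq : 1 ≤ q) {n : ℕ} (hn : 1 ≤ n)
    (μ : Fin n → RegMeasure Ω) :
    IsLUB {r : ℝ | ∃ X : Fin n → Set Ω, IsMeasurablePartition X ∧
        r = (∑ i, ‖(μ i).proj (X i)‖ ^ q) ^ (1 / q)}
      (weakMultiNorm 1 q μ) := by
  have hle : ∀ B : ℝ, (∀ X : Fin n → Set Ω, IsMeasurablePartition X →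
      (∑ i, ‖(μ i).proj (X i)‖ ^ q) ^ (1 / q) ≤ B) →
      B ∈ upperBounds {r : ℝ | ∃ φ : Fin n → StrongDual ℂ (RegMeasure Ω),
        weakSummingNorm 1 φ ≤ 1 ∧ r = (∑ i, ‖φ i (μ i)‖ ^ q) ^ (1 / q)} := by
    rintro B hB r ⟨φ, hφ, rfl⟩
    exact rpow_sum_norm_apply_le_of_forall_partition hn hq
      (sum_norm_apply_le_of_weakSummingNorm_le_one hφ) hB
  -- Contractivity of the projections gives a bound independent of `X`, so the supremum defining
  -- `weakMultiNorm` is finite.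
  have hbdd := hle ((∑ i, ‖μ i‖ ^ q) ^ (1 / q)) fun X hX =>
    Real.rpow_le_rpow (Finset.sum_nonneg fun _ _ => by positivity)
      (Finset.sum_le_sum fun i _ => Real.rpow_le_rpow (norm_nonneg _)
        (RegMeasure.norm_proj_le (hX.measurableSet i) _) (by linarith))
      (one_div_nonneg.2 (by linarith))
  refine ⟨?_, fun B hB => ?_⟩
  · rintro r ⟨X, hX, rfl⟩
    obtain ⟨φ, hφ, hφμ⟩ := hX.exists_dual μ
    refine le_csSup ⟨_, hbdd⟩ ⟨φ, hφ, ?_⟩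
    simp only [hφμ]
  · refine csSup_le ⟨_, 0, weakSummingNorm_le_one_of_sum_norm_apply_le fun e => by simp, rfl⟩
      (hle B fun X hX => hB ⟨X, hX, rfl⟩)

end WeakMultiNorm

/-- (1) The maximum multi-norm over `M(Ω)` is `‖|μ_1| ∨ ⋯ ∨ |μ_n|‖`, the total mass of the
supremum of the positive measures `|μ_i|`.
(2) For `1 ≤ q < ∞`, the weak `(1,q)`-multi-norm over `M(Ω)` is the supremum of
`(∑ ‖P_{X_i} μ_i‖^q)^{1/q}` over the measurable partitions `(X_1, …, X_n)` of `Ω`. -/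
theorem mainTheorem9 {Ω : Type*} [TopologicalSpace Ω] [T2Space Ω] [LocallyCompactSpace Ω]
    [MeasurableSpace Ω] [BorelSpace Ω] :
    IsMaximumMultiNorm (E := RegMeasure Ω)
      (fun _ μ => ((⨆ i, (μ i).abs) Set.univ).toReal) ∧
    ∀ q : ℝ, 1 ≤ q → ∀ n : ℕ, 1 ≤ n → ∀ μ : Fin n → RegMeasure Ω,
      IsLUB {r : ℝ | ∃ X : Fin n → Set Ω, IsMeasurablePartition X ∧
          r = (∑ i, ‖(μ i).proj (X i)‖ ^ q) ^ (1 / q)}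
        (weakMultiNorm 1 q μ) :=
  ⟨isMaximumMultiNorm_toReal_iSup_abs, fun _ hq _ hn μ => isLUB_weakMultiNorm_one hq hn μ⟩
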